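/- **Conventions.** A *hypergraph* $\mathcal F=(V,E,H,\psi,\phi)$ consists of finite sets $V$ (vertices), $E$ (hyperedges), $H$ (hinges), a function $\psi:H\to V$ and a surjection $\phi:H\to E$; a hinge $h$ is incident with the vertex $\psi(h)$ and the hyperedge $\phi(h)$. The degree $d_{\mathcal F}(x)$ is the number of hinges incident with $x$. Suppose every hyperedge is incident with exactly three hinges. For (not necessarily distinct) vertices $x,y,z$, the multiplicity $m_{\mathcal F}(x,y,z)$ is the number of hyperedges whose three hinges are incident with $x,y,z$, counted with multiplicity (so $m_{\mathcal F}(x,x,y)$ with $x\ne y$ counts the hyperedges with two hinges at $x$ and one at $y$). $\mathcal F$ is *3-uniform* if every hyperedge is incident with exactly three hinges and with exactly three distinct vertices. A $k$-hyperedge-colouring is a map $K:E\to\{1,\dots,k\}$, and $\mathcal F(j)$ is the sub-hypergraph with vertex set $V$, the hyperedges of colour $j$, and the hinges incident with those hyperedges. If $\mathcal G=(W,E,H,\psi',\phi)$ is a hypergraph and $\Psi:W\to V$ is onto with $\psi=\Psi\circ\psi'$ and $|\Psi^{-1}(x)|=g(x)$ for all $x\in V$, then $\mathcal G$ is a *$g$-detachment*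 of $\mathcal F$ with amalgamation function $\Psi$; it has the same hyperedges and hinges, hence carries the same hyperedge-colouring. For real $a,b$ write $a\approx b$ for $\lfloor b\rfloor\le a\le\lceil b\rceil$. For $g:V\to\{1,2,3,\dots\}$ let $\tilde g$ be the symmetric function on $V^3$ with $\tilde g(x,x,x)=\binom{g(x)}{3}$, $\tilde g(x,x,y)=\binom{g(x)}{2}g(y)$ and $\tilde g(x,y,z)=g(x)g(y)g(z)$ for distinct $x,y,z$. **Theorem 3.1.** Let $\mathcal F$ be a $k$-hyperedge-coloured hypergraph in which every hyperedge is incident with exactly three hinges, and let $g:V(\mathcal F)\to\{1,2,3,\dots\}$ be such that for each $x\in V(\mathcal F)$: if $g(x)\le 2$ then $m_{\mathcal F}(x,x,x)=0$, and if $g(x)=1$ then $m_{\mathcal F}(x,x,y)=0$ for every $y\in V(\mathcal F)$. Then there exists a 3-uniform $g$-detachment $\mathcal G$ of $\mathcal F$ (possibly with multiple hyperedges), with amalgamation function $\Psi:V(\mathcal G)\to V(\mathcal F)$, such that: * (A1) $d_{\mathcal G}(u)\approx d_{\mathcal F}(x)/g(x)$ for each $x\in V(\mathcal F)$ and each $u\in\Psi^{-1}(x)$;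 * (A2) $d_{\mathcal G(j)}(u)\approx d_{\mathcal F(j)}(x)/g(x)$ for each $x\in V(\mathcal F)$, each $u\in\Psi^{-1}(x)$ and each $j\in\{1,\dots,k\}$; * (A3) $m_{\mathcal G}(u,v,w)\approx m_{\mathcal F}(x,y,z)/\tilde g(x,y,z)$ for all $x,y,z\in V(\mathcal F)$ and every triple of distinct vertices $u\in\Psi^{-1}(x)$, $v\in\Psi^{-1}(y)$, $w\in\Psi^{-1}(z)$; * (A4) $m_{\mathcal G(j)}(u,v,w)\approx m_{\mathcal F(j)}(x,y,z)/\tilde g(x,y,z)$ for all $x,y,z$ and $u,v,w$ as in (A3) and each $j\in\{1,\dots,k\}$. In (A3) and (A4), if $x=y=z$ then such $u,v,w$ exist only when $g(x)\ge 3$, and if exactly two of $x,y,z$ coincide then only when the repeated vertex has $g\ge 2$; so $\tilde g(x,y,z)>0$ there. -/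

import Mathlib

universe u v w

/-- A hypergraph in the sense of hinges: vertices `V`, hyperedges `E`, hinges `H`, a function
`ψ` sending each hinge to the vertex it is incident with, and a surjection `φ` sending each hinge
to the hyperedge it is incident with. Finiteness of `V`, `E`, `H` is required where the notion
is used, through `Finite` instances. -/
structure HingedHypergraph (V : Type u) (E : Type v) (H : Type w) where
  ψ : H → V
  φ : H → E
  φ_surjective : Function.Surjective φ

namespace HingedHypergraph

/-- The set of hinges incident with the vertex `x`. -/
def hingesAtVertex {V : Type u} {E : Type v} {H : Type w} (G : HingedHypergraph V E H)
    (x : V) : Set H :=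
  G.ψ ⁻¹' {x}

/-- The set of hinges incident with the hyperedge `e`. -/
def hingesAtEdge {V : Type u} {E : Type v} {H : Type w} (G : HingedHypergraph V E H)
    (e : E) : Set H :=
  G.φ ⁻¹' {e}

/-- The degree of a vertex: the number of hinges incident with it. -/
noncomputable def degree {V : Type u} {E : Type v} {H : Type w} (G : HingedHypergraph V E H)
    (x : V) : ℕ :=
  (G.hingesAtVertex x).ncard

/-- The size of a hyperedge: the number of vertices incident with it. -/
noncomputable def size {V : Type u} {E : Type v} {H : Type w} (G : HingedHypergraph V E H)
    (e : E) : ℕ :=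
  (G.ψ '' G.hingesAtEdge e).ncard

/-- A hypergraph is `r`-uniform if every hyperedge is incident with exactly `r` vertices and
with exactly `r` hinges. -/
def IsUniform {V : Type u} {E : Type v} {H : Type w} (G : HingedHypergraph V E H)
    (r : ℕ) : Prop :=
  ∀ e : E, G.size e = r ∧ (G.hingesAtEdge e).ncard = r

/-- `G.nabla x y z` is the set of hyperedges incident with exactly three hinges, attaching them
to `x`, `y` and `z` (not necessarily distinct, counted with multiplicity). Thus `G.nabla x x y`
with `x ≠ y` consists of the hyperedges with two hinges at `x` and one at `y`, and `G.nabla x x x`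
of the hyperedges with three hinges at `x`. -/
def nabla {V : Type u} {E : Type v} {H : Type w} (G : HingedHypergraph V E H)
    (x y z : V) : Set E :=
  {e | ∃ h₁ h₂ h₃ : H, h₁ ≠ h₂ ∧ h₁ ≠ h₃ ∧ h₂ ≠ h₃ ∧ G.hingesAtEdge e = {h₁, h₂, h₃} ∧
    G.ψ h₁ = x ∧ G.ψ h₂ = y ∧ G.ψ h₃ = z}

/-- The multiplicity `m(x, y, z)`. -/
noncomputable def mult {V : Type u} {E : Type v} {H : Type w} (G : HingedHypergraph V E H)
    (x y z : V) : ℕ :=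
  (G.nabla x y z).ncard

/-- The (spanning) sub-hypergraph induced by the colour class `j` of a hyperedge-colouring `K`:
all vertices, the hyperedges of colour `j`, and the hinges incident with them. -/
def colorClass {V : Type u} {E : Type v} {H : Type w} (G : HingedHypergraph V E H)
    {k : ℕ} (K : E → Fin k) (j : Fin k) :
    HingedHypergraph V {e : E // K e = j} {h : H // K (G.φ h) = j} where
  ψ h := G.ψ h.1
  φ h := ⟨G.φ h.1, h.2⟩
  φ_surjective := by
    rintro ⟨e, he⟩
    obtain ⟨h, rfl⟩ := G.φ_surjective e
    exact ⟨⟨h, he⟩, rfl⟩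

/-- `F` is the `Ψ`-amalgamation of `G` (that is, `G` is a detachment of `F` with amalgamation
function `Ψ`): `Ψ` is onto, the two hypergraphs have the same hyperedges and hinges, and each
hinge at `u` in `G` is at `Ψ u` in `F`. -/
structure IsAmalgamation {V W : Type u} {E : Type v} {H : Type w} (Ψ : W → V)
    (G : HingedHypergraph W E H) (F : HingedHypergraph V E H) : Prop where
  surjective : Function.Surjective Ψ
  ψ_eq : F.ψ = Ψ ∘ G.ψ
  φ_eq : F.φ = G.φ

/-- `G` is a `g`-detachment of `F` with amalgamation function `Ψ`, i.e. `g` is the number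
function `x ↦ |Ψ⁻¹(x)|` of `Ψ`. -/
def IsDetachment {V W : Type u} {E : Type v} {H : Type w} (g : V → ℕ) (Ψ : W → V)
    (G : HingedHypergraph W E H) (F : HingedHypergraph V E H) : Prop :=
  IsAmalgamation Ψ G F ∧ ∀ x : V, g x = (Ψ ⁻¹' {x}).ncard

end HingedHypergraph

open Classical in
/-- The symmetric function `g̃` on triples: for distinct `x, y, z`,
`g̃(x,x,x) = C(g x, 3)`, `g̃(x,x,y) = g̃(x,y,x) = g̃(y,x,x) = C(g x, 2) * g y`,
`g̃(x,y,z) = g x * g y * g z`. -/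
noncomputable def gTilde {V : Type u} (g : V → ℕ) (x y z : V) : ℕ :=
  if x = y then
    if y = z then (g x).choose 3 else (g x).choose 2 * g z
  else if x = z then (g x).choose 2 * g y
  else if y = z then (g y).choose 2 * g x
  else g x * g y * g z

/-- `a ≈ b`, meaning `⌊b⌋ ≤ a ≤ ⌈b⌉` (not a symmetric relation). -/
def RoundsTo (a b : ℝ) : Prop :=
  (⌊b⌋ : ℝ) ≤ a ∧ a ≤ (⌈b⌉ : ℝ)

/-!
The detachment is built by splitting off one vertex at a time. Suppose that the vertex `x` is to be
replaced by `g x = n` vertices. A new vertex should receive a set `Z` of hinges at `x` that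
contains the proportion `1 / n`, rounded up or down, of the hinges at `x` of each kind: all of them,
those of each colour, those in hyperedges of each type (the *type* of a hyperedge being the multiset
of its vertices), those of each type and colour, and those in each single hyperedge. Such a `Z`
exists by Nash-Williams' lemma (`IsLaminar.exists_equitable_subset`), since these kinds form two
laminar families: everything, colours, types within a colour and single hyperedges on the one hand,
types on the other. As no hyperedge has more than `g x` hinges at `x`, at most one of its hinges is
moved.

Nash-Williams' lemma holds because the constant function `1 / n` can be moved to an integral point
without letting the sum over a member of the families cross an integer. A direction of motion that
fixes all sums which are integers already is found by counting dimensions: the disjoint atoms of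
each laminar family of integral sums have at least two fractional elements each
(`exists_ne_zero_sum_eq_zero`).

All fairness conditions are kept as integer bounds (`SharesFairly`): if `q * g x ≤ d x` before the
splitting, then `q * g' u ≤ d' u` afterwards for the vertices `u` above `x`, and likewise for upper
bounds. In this form they are transitive, while iterated rounding is not. For the multiplicity of
a type `s` the role of `g x` is played by the weight `∏ x, (g x).choose (s x)`, which is `gTilde`
when `s` has three elements. If `s` contains `x` exactly `c` times, then the `m` hyperedges of type
`s` have `c * m` hinges at `x`, of which about `c * m / n` are moved; this matches the splitting of
the weight by Pascal's rule, since `n * (n - 1).choose (c - 1) = c * n.choose c` and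
`n * (n - 1).choose c = (n - c) * n.choose c`
(`exists_isFairDetachment_splitVertex`). The conditions on small values of `g` say that every
hyperedge has a type of positive weight. The upper bounds preserve this, so that in the end,
when all numbers are `1`, no hyperedge meets a vertex twice.
-/

open Finset

/-! ### Simultaneous rounding over two laminar families -/

/-- A family of finite sets is laminar if any two members are nested or disjoint. -/
def IsLaminar {S : Type*} (𝒜 : Set (Finset S)) : Prop :=
  ∀ P ∈ 𝒜, ∀ Q ∈ 𝒜, P ⊆ Q ∨ Q ⊆ P ∨ Disjoint P Q

namespace IsLaminar

variable {S : Type*} [DecidableEq S]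

/-- The part of `P` that is not covered by the members of `T` strictly inside `P`. -/
def atom (T : Finset (Finset S)) (P : Finset S) : Finset S :=
  P.filter fun s => ∀ Q ∈ T, Q ⊂ P → s ∉ Q

theorem disjoint_atom {T : Finset (Finset S)} (hT : IsLaminar (T : Set (Finset S)))
    {P Q : Finset S} (hP : P ∈ T) (hQ : Q ∈ T) (hne : P ≠ Q) :
    Disjoint (atom T P) (atom T Q) := by
  rw [Finset.disjoint_left]
  intro s hs hs'
  simp only [atom, mem_filter] at hs hs'
  rcases hT P hP Q hQ with h | h | h
  · exact hs'.2 P hP (h.ssubset_of_ne hne) hs.1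
  · exact hs.2 Q hQ (h.ssubset_of_ne hne.symm) hs'.1
  · exact Finset.disjoint_left.1 h hs.1 hs'.1

/-- Every member of a laminar family is the disjoint union of the atoms of the members
inside it. -/
theorem sum_eq_sum_atom {T : Finset (Finset S)} (hT : IsLaminar (T : Set (Finset S)))
    {P : Finset S} (hP : P ∈ T) (f : S → ℝ) :
    ∑ s ∈ P, f s = ∑ Q ∈ T with Q ⊆ P, ∑ s ∈ atom T Q, f s := by
  rw [← sum_biUnion]
  · congr 1
    ext s
    simp only [mem_biUnion, mem_filter]
    constructor
    · intro hs
      obtain ⟨Q, hQ, hmin⟩ := exists_min_image (T.filter (s ∈ ·)) card ⟨P, by simp [hP, hs]⟩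
      simp only [mem_filter] at hQ hmin
      refine ⟨Q, ⟨hQ.1, ?_⟩, ?_⟩
      · rcases hT P hP Q hQ.1 with h | h | h
        · exact (eq_of_subset_of_card_le h (hmin P ⟨hP, hs⟩)).ge
        · exact h
        · exact absurd hQ.2 (Finset.disjoint_left.1 h hs)
      · refine mem_filter.2 ⟨hQ.2, fun R hR hRQ hsR => ?_⟩
        exact absurd (card_lt_card hRQ) (not_lt.2 (hmin R ⟨hR, hsR⟩))
    · rintro ⟨Q, ⟨-, hQP⟩, hs⟩
      exact hQP (mem_filter.1 hs).1
  · intro Q hQ R hR hne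
    exact disjoint_atom hT (mem_filter.1 hQ).1 (mem_filter.1 hR).1 hne

/-- If `f` sums to an integer over every member of a laminar family, it sums to an integer over
every atom. -/
theorem sum_atom_mem_range {T : Finset (Finset S)} (hT : IsLaminar (T : Set (Finset S)))
    (f : S → ℝ) (hf : ∀ P ∈ T, ∑ s ∈ P, f s ∈ (Int.castAddHom ℝ).range) :
    ∀ (n : ℕ) (P : Finset S), #P = n → P ∈ T → ∑ s ∈ atom T P, f s ∈ (Int.castAddHom ℝ).range := by
  intro n
  induction n using Nat.strong_induction_on with
  | _ n ih =>
    intro P hn hP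
    have h := sum_eq_sum_atom hT hP f
    rw [← add_sum_erase _ _ (show P ∈ T.filter (· ⊆ P) by simp [hP])] at h
    rw [← sub_eq_iff_eq_add] at h
    rw [← h]
    refine sub_mem (hf P hP) (sum_mem fun Q hQ => ?_)
    simp only [mem_erase, mem_filter] at hQ
    exact ih _ (hn ▸ card_lt_card (hQ.2.2.ssubset_of_ne hQ.1)) Q rfl hQ.2.1

end IsLaminar

/-- If the members of each of two families of disjoint subsets of a nonempty set `F` have at least
two elements, then some nonzero vector supported on `F` sums to zero over every member. There
are at most `#F` conditions; when there are exactly `#F`, both families partition `F`, so that the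
conditions of the first family and those of the second add up to the same functional. -/
theorem exists_ne_zero_sum_eq_zero {S : Type*} [Fintype S] [DecidableEq S] (F : Finset S)
    (hF : F.Nonempty) (𝒰 𝒱 : Finset (Finset S))
    (h𝒰 : (𝒰 : Set (Finset S)).PairwiseDisjoint id) (h𝒱 : (𝒱 : Set (Finset S)).PairwiseDisjoint id)
    (h𝒰F : ∀ P ∈ 𝒰, P ⊆ F ∧ 2 ≤ #P) (h𝒱F : ∀ P ∈ 𝒱, P ⊆ F ∧ 2 ≤ #P) :
    ∃ d : S → ℝ, d ≠ 0 ∧ (∀ s ∉ F, d s = 0) ∧ (∀ P ∈ 𝒰, ∑ s ∈ P, d s = 0) ∧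
      ∀ P ∈ 𝒱, ∑ s ∈ P, d s = 0 := by
  have hcard : ∀ 𝒲 : Finset (Finset S), (𝒲 : Set (Finset S)).PairwiseDisjoint id →
      (∀ P ∈ 𝒲, P ⊆ F ∧ 2 ≤ #P) → 2 * #𝒲 ≤ #F ∧ (2 * #𝒲 = #F → 𝒲.biUnion id = F) := by
    intro 𝒲 hd hs
    have h1 : 𝒲.biUnion id ⊆ F := biUnion_subset.2 fun P hP => (hs P hP).1
    have h2 : #(𝒲.biUnion id) = ∑ P ∈ 𝒲, #P := card_biUnion hd
    have h3 : #𝒲 * 2 ≤ ∑ P ∈ 𝒲, #P := by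
      simpa using card_nsmul_le_sum 𝒲 card 2 fun P hP => (hs P hP).2
    have h4 := card_le_card h1
    exact ⟨by omega, fun h => eq_of_subset_of_card_le h1 (by omega)⟩
  obtain ⟨hc𝒰, he𝒰⟩ := hcard 𝒰 h𝒰 h𝒰F
  obtain ⟨hc𝒱, he𝒱⟩ := hcard 𝒱 h𝒱 h𝒱F
  let p : 𝒰 ⊕ 𝒱 ⊕ (Fᶜ : Finset S) → Finset S :=
    Sum.elim (fun P => P.1) (Sum.elim (fun P => P.1) fun s => {s.1})
  let L : (S → ℝ) →ₗ[ℝ] (𝒰 ⊕ 𝒱 ⊕ (Fᶜ : Finset S) → ℝ) :=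
    LinearMap.pi fun i => ∑ s ∈ p i, LinearMap.proj s
  have hL : ∀ d i, L d i = ∑ s ∈ p i, d s := fun d i => by simp [L]
  have hninj : ¬ Function.Injective L := by
    intro hinj
    have hle := LinearMap.finrank_le_finrank_of_injective hinj
    have hFc : #Fᶜ = Fintype.card S - #F := card_compl F
    have hFS : #F ≤ Fintype.card S := card_le_univ F
    have hpos : 0 < #F := hF.card_pos
    have hdim : Module.finrank ℝ (𝒰 ⊕ 𝒱 ⊕ (Fᶜ : Finset S) → ℝ) = #𝒰 + (#𝒱 + #Fᶜ) := by
      rw [Module.finrank_fintype_fun_eq_card, Fintype.card_sum, Fintype.card_sum,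
        Fintype.card_coe, Fintype.card_coe, Fintype.card_coe]
    rw [hdim, Module.finrank_fintype_fun_eq_card] at hle
    have hsurj : Function.Surjective L := by
      refine (LinearMap.injective_iff_surjective_of_finrank_eq_finrank ?_).1 hinj
      rw [hdim, Module.finrank_fintype_fun_eq_card]
      omega
    obtain ⟨P₀, hP₀⟩ : 𝒰.Nonempty := card_pos.1 (by omega)
    obtain ⟨d, hd⟩ := hsurj (Pi.single (Sum.inl ⟨P₀, hP₀⟩) 1)
    have hval : ∀ i, ∑ s ∈ p i, d s = Pi.single (M := fun _ => ℝ) (Sum.inl ⟨P₀, hP₀⟩) 1 i :=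
      fun i => by rw [← hL, hd]
    have h1 : ∑ s ∈ F, d s = 1 := by
      rw [← he𝒰 (by omega), sum_biUnion h𝒰, ← add_sum_erase _ _ hP₀]
      have h0 : ∑ s ∈ P₀, d s = 1 := by simpa [p] using hval (Sum.inl ⟨P₀, hP₀⟩)
      rw [id, h0, sum_eq_zero, add_zero]
      intro Q hQ
      have := hval (Sum.inl ⟨Q, mem_of_mem_erase hQ⟩)
      rwa [Pi.single_eq_of_ne (by simpa using ne_of_mem_erase hQ)] at this
    have h2 : ∑ s ∈ F, d s = 0 := by
      rw [← he𝒱 (by omega), sum_biUnion h𝒱]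
      refine sum_eq_zero fun Q hQ => ?_
      simpa [p] using hval (Sum.inr (Sum.inl ⟨Q, hQ⟩))
    linarith
  obtain ⟨d, hd, hne⟩ : ∃ d, L d = 0 ∧ d ≠ 0 := by
    by_contra! h
    exact hninj ((injective_iff_map_eq_zero L).2 h)
  have hval : ∀ i, ∑ s ∈ p i, d s = 0 := fun i => by rw [← hL, hd]; rfl
  refine ⟨d, hne, fun s hs => ?_, fun P hP => hval (Sum.inl ⟨P, hP⟩),
    fun P hP => hval (Sum.inr (Sum.inl ⟨P, hP⟩))⟩
  simpa [p] using hval (Sum.inr (Sum.inr ⟨s, by simpa using hs⟩))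

namespace IsLaminar

variable {S : Type*} [DecidableEq S]

/-- The nonempty traces of the atoms on the set of fractional elements have at least two elements:
`x` sums to an integer over every atom, so no atom has exactly one fractional element. -/
theorem exists_disjoint_family {T : Finset (Finset S)} (hT : IsLaminar (T : Set (Finset S)))
    {x : S → ℝ} (hx : ∀ P ∈ T, ∑ s ∈ P, x s ∈ (Int.castAddHom ℝ).range)
    {F : Finset S} (hF : ∀ s, s ∈ F ↔ x s ∉ (Int.castAddHom ℝ).range) :
    ∃ 𝒰 : Finset (Finset S), (𝒰 : Set (Finset S)).PairwiseDisjoint id ∧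
      (∀ P ∈ 𝒰, P ⊆ F ∧ 2 ≤ #P) ∧
      ∀ d : S → ℝ, (∀ s ∉ F, d s = 0) → (∀ P ∈ 𝒰, ∑ s ∈ P, d s = 0) →
        ∀ P ∈ T, ∑ s ∈ P, d s = 0 := by
  refine ⟨(T.image fun P => atom T P ∩ F).filter Finset.Nonempty, ?_, ?_, ?_⟩
  · intro P' hP' Q' hQ' hne
    simp only [coe_filter, mem_image, Set.mem_ofPred_eq] at hP' hQ'
    obtain ⟨⟨P, hP, rfl⟩, -⟩ := hP'
    obtain ⟨⟨Q, hQ, rfl⟩, -⟩ := hQ'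
    have hPQ : P ≠ Q := fun h => hne (by rw [h])
    exact (disjoint_atom hT hP hQ hPQ).mono inter_subset_left inter_subset_left
  · intro P' hP'
    simp only [mem_filter, mem_image] at hP'
    obtain ⟨⟨P, hP, rfl⟩, hne⟩ := hP'
    refine ⟨inter_subset_right, ?_⟩
    by_contra hlt
    have h1 : #(atom T P ∩ F) = 1 := by have := hne.card_pos; omega
    obtain ⟨s, hs⟩ := card_eq_one.1 h1
    have hsF : s ∈ F := (mem_inter.1 (hs ▸ mem_singleton_self s : s ∈ atom T P ∩ F)).2
    have hsum := sum_atom_mem_range hT x hx _ P rfl hP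
    rw [← sum_inter_add_sum_sdiff _ F, hs, sum_singleton] at hsum
    refine (hF s).1 hsF ((AddSubgroup.add_mem_cancel_right _ (sum_mem fun r hr => ?_)).1 hsum)
    by_contra hr'
    exact (mem_sdiff.1 hr).2 ((hF r).2 hr')
  · intro d hd h𝒰 P hP
    rw [sum_eq_sum_atom hT hP d]
    refine sum_eq_zero fun Q hQ => ?_
    rw [← sum_inter_add_sum_sdiff _ F, sum_eq_zero (s := atom T Q \ F)
      (fun s hs => hd s (mem_sdiff.1 hs).2), add_zero]
    by_cases hne : (atom T Q ∩ F).Nonempty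
    · exact h𝒰 _ (mem_filter.2 ⟨mem_image_of_mem _ (mem_filter.1 hQ).1, hne⟩)
    · rw [not_nonempty_iff_eq_empty.1 hne, sum_empty]

/-- One step of the rounding: if `x` is not integral, it can be moved, keeping all sums over members
of `𝒜 ∪ ℬ` between the same consecutive integers, until one more of these sums is an integer. -/
theorem exists_move [Fintype S] {𝒜 ℬ : Finset (Finset S)}
    (h𝒜 : IsLaminar (𝒜 : Set (Finset S))) (hℬ : IsLaminar (ℬ : Set (Finset S)))
    (hsingle : ∀ s : S, {s} ∈ 𝒜) {x : S → ℝ} (hx : ∃ s, x s ∉ (Int.castAddHom ℝ).range) :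
    ∃ x' : S → ℝ,
      (∀ P ∈ 𝒜 ∪ ℬ, (⌊∑ s ∈ P, x s⌋ : ℝ) ≤ ∑ s ∈ P, x' s ∧ ∑ s ∈ P, x' s ≤ ⌈∑ s ∈ P, x s⌉) ∧
      (∀ P ∈ 𝒜 ∪ ℬ, ∑ s ∈ P, x s ∈ (Int.castAddHom ℝ).range →
        ∑ s ∈ P, x' s ∈ (Int.castAddHom ℝ).range) ∧
      ∃ P ∈ 𝒜 ∪ ℬ, ∑ s ∈ P, x s ∉ (Int.castAddHom ℝ).range ∧
        ∑ s ∈ P, x' s ∈ (Int.castAddHom ℝ).range := by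
  classical
  let F : Finset S := univ.filter fun s => x s ∉ (Int.castAddHom ℝ).range
  have hF : ∀ s, s ∈ F ↔ x s ∉ (Int.castAddHom ℝ).range := fun s => by simp [F]
  have hsub : ∀ 𝒞 : Finset (Finset S), IsLaminar (𝒞 : Set (Finset S)) →
      IsLaminar ((𝒞.filter fun P => ∑ s ∈ P, x s ∈ (Int.castAddHom ℝ).range : Finset (Finset S)) :
        Set (Finset S)) := fun 𝒞 h P hP Q hQ =>
    h P (mem_filter.1 hP).1 Q (mem_filter.1 hQ).1
  obtain ⟨𝒰, h𝒰, h𝒰F, h𝒰0⟩ :=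
    exists_disjoint_family (hsub 𝒜 h𝒜) (fun P hP => (mem_filter.1 hP).2) hF
  obtain ⟨𝒱, h𝒱, h𝒱F, h𝒱0⟩ :=
    exists_disjoint_family (hsub ℬ hℬ) (fun P hP => (mem_filter.1 hP).2) hF
  obtain ⟨s₀, hs₀⟩ := hx
  obtain ⟨d, hd, hdF, hd𝒰, hd𝒱⟩ :=
    exists_ne_zero_sum_eq_zero F ⟨s₀, (hF _).2 hs₀⟩ 𝒰 𝒱 h𝒰 h𝒱 h𝒰F h𝒱F
  -- `d` does not change the sums that are integers already
  have htight : ∀ P ∈ 𝒜 ∪ ℬ, ∑ s ∈ P, x s ∈ (Int.castAddHom ℝ).range → ∑ s ∈ P, d s = 0 := by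
    intro P hP hPx
    rcases mem_union.1 hP with h | h
    · exact h𝒰0 d hdF hd𝒰 P (mem_filter.2 ⟨h, hPx⟩)
    · exact h𝒱0 d hdF hd𝒱 P (mem_filter.2 ⟨h, hPx⟩)
  -- `t P` is the time at which the sum over `P` reaches an integer
  let t : Finset S → ℝ := fun P =>
    ((if 0 < ∑ s ∈ P, d s then (⌈∑ s ∈ P, x s⌉ : ℝ) else (⌊∑ s ∈ P, x s⌋ : ℝ)) - ∑ s ∈ P, x s) /
      ∑ s ∈ P, d s
  have ht0 : ∀ P, 0 ≤ t P := by
    intro P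
    simp only [t]
    split_ifs with h
    · exact div_nonneg (sub_nonneg.2 (Int.le_ceil _)) h.le
    · exact div_nonneg_of_nonpos (sub_nonpos.2 (Int.floor_le _)) (not_lt.1 h)
  obtain ⟨s₁, hs₁⟩ := Function.ne_iff.1 hd
  obtain ⟨P₀, hP₀, hmin⟩ := exists_min_image ((𝒜 ∪ ℬ).filter fun P => ∑ s ∈ P, d s ≠ 0) t
    ⟨{s₁}, mem_filter.2 ⟨mem_union_left _ (hsingle s₁), by simpa using hs₁⟩⟩
  obtain ⟨hP₀, hP₀d⟩ := mem_filter.1 hP₀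
  have hsum : ∀ P : Finset S, ∑ s ∈ P, (x s + t P₀ * d s) = ∑ s ∈ P, x s + t P₀ * ∑ s ∈ P, d s :=
    fun P => by rw [sum_add_distrib, mul_sum]
  refine ⟨fun s => x s + t P₀ * d s, fun P hP => ?_, fun P hP hPx => ?_, P₀, hP₀,
    fun h => hP₀d (htight P₀ hP₀ h), ?_⟩
  · rw [hsum]
    have hfl := Int.floor_le (∑ s ∈ P, x s)
    have hce := Int.le_ceil (∑ s ∈ P, x s)
    rcases eq_or_ne (∑ s ∈ P, d s) 0 with h0 | h0
    · rw [h0, mul_zero, add_zero]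
      exact ⟨hfl, hce⟩
    · have hle := hmin P (mem_filter.2 ⟨hP, h0⟩)
      have heq : t P * ∑ s ∈ P, d s =
          (if 0 < ∑ s ∈ P, d s then (⌈∑ s ∈ P, x s⌉ : ℝ) else (⌊∑ s ∈ P, x s⌋ : ℝ)) -
            ∑ s ∈ P, x s := div_mul_cancel₀ _ h0
      split_ifs at heq with hpos
      · have h1 := mul_le_mul_of_nonneg_right hle hpos.le
        have h2 := mul_nonneg (ht0 P₀) hpos.le
        constructor <;> linarith
      · have h1 := mul_le_mul_of_nonpos_right hle (not_lt.1 hpos)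
        have h2 := mul_nonpos_of_nonneg_of_nonpos (ht0 P₀) (not_lt.1 hpos)
        constructor <;> linarith
  · rw [hsum, htight P hP hPx, mul_zero, add_zero]
    exact hPx
  · rw [hsum, div_mul_cancel₀ _ hP₀d]
    split_ifs
    · exact ⟨⌈∑ s ∈ P₀, x s⌉, by simp⟩
    · exact ⟨⌊∑ s ∈ P₀, x s⌋, by simp⟩

/-- Simultaneous rounding for two laminar families, one of which contains all singletons. -/
theorem exists_int_rounding [Fintype S] {𝒜 ℬ : Finset (Finset S)}
    (h𝒜 : IsLaminar (𝒜 : Set (Finset S))) (hℬ : IsLaminar (ℬ : Set (Finset S)))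
    (hsingle : ∀ s : S, {s} ∈ 𝒜) (x : S → ℝ) :
    ∃ y : S → ℤ, ∀ P ∈ 𝒜 ∪ ℬ, ⌊∑ s ∈ P, x s⌋ ≤ ∑ s ∈ P, y s ∧ ∑ s ∈ P, y s ≤ ⌈∑ s ∈ P, x s⌉ := by
  classical
  induction hn : #((𝒜 ∪ ℬ).filter fun P => ∑ s ∈ P, x s ∉ (Int.castAddHom ℝ).range)
    using Nat.strong_induction_on generalizing x with
  | _ n ih =>
    by_cases hx : ∃ s, x s ∉ (Int.castAddHom ℝ).range
    · obtain ⟨x', hbd, hkeep, P₀, hP₀, hP₀x, hP₀x'⟩ := exists_move h𝒜 hℬ hsingle hx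
      obtain ⟨y, hy⟩ := ih _ (by
        rw [← hn]
        refine card_lt_card ⟨fun P hP => ?_, fun h => ?_⟩
        · rw [mem_filter] at hP ⊢
          exact ⟨hP.1, fun h => hP.2 (hkeep P hP.1 h)⟩
        · exact (mem_filter.1 (h (mem_filter.2 ⟨hP₀, hP₀x⟩))).2 hP₀x') x' rfl
      refine ⟨y, fun P hP => ⟨(Int.le_floor.2 (hbd P hP).1).trans (hy P hP).1,
        (hy P hP).2.trans (Int.ceil_le.2 (hbd P hP).2)⟩⟩
    · push Not at hx
      choose y hy using hx
      refine ⟨y, fun P hP => ?_⟩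
      have h : ∑ s ∈ P, x s = ((∑ s ∈ P, y s : ℤ) : ℝ) := by
        push_cast
        exact sum_congr rfl fun s _ => (hy s).symm
      rw [h, Int.floor_intCast, Int.ceil_intCast]
      exact ⟨le_rfl, le_rfl⟩

/-- **Nash-Williams' lemma.** Given two laminar families of subsets of a finite set, some
subset `Z` contains, up to rounding, the proportion `1 / n` of every member of either family.
The inequalities say that `#(P ∩ Z)` differs from `#P / n` by less than `1`. -/
theorem exists_equitable_subset [Fintype S] {𝒜 ℬ : Set (Finset S)} (h𝒜 : IsLaminar 𝒜)
    (hℬ : IsLaminar ℬ) {n : ℕ} (hn : 0 < n) :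
    ∃ Z : Finset S, ∀ P ∈ 𝒜 ∪ ℬ, n * #(P ∩ Z) < #P + n ∧ #P < n * #(P ∩ Z) + n := by
  classical
  let 𝒜' : Finset (Finset S) := univ.filter fun P => P ∈ 𝒜 ∨ ∃ s, P = {s}
  let ℬ' : Finset (Finset S) := univ.filter fun P => P ∈ ℬ
  have h𝒜' : IsLaminar (𝒜' : Set (Finset S)) := by
    have hs : ∀ (s : S) (Q : Finset S), {s} ⊆ Q ∨ Disjoint {s} Q := fun s Q => by
      rw [singleton_subset_iff, disjoint_singleton_left]
      exact em _
    intro P hP Q hQ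
    simp only [𝒜', coe_filter, mem_univ, true_and, Set.mem_ofPred_eq] at hP hQ
    rcases hP with hP | ⟨s, rfl⟩
    · rcases hQ with hQ | ⟨s, rfl⟩
      · exact h𝒜 P hP Q hQ
      · rcases hs s P with h | h
        · exact .inr (.inl h)
        · exact .inr (.inr h.symm)
    · rcases hs s Q with h | h
      · exact .inl h
      · exact .inr (.inr h)
  have hℬ' : IsLaminar (ℬ' : Set (Finset S)) := fun P hP Q hQ =>
    hℬ P (mem_filter.1 hP).2 Q (mem_filter.1 hQ).2
  obtain ⟨y, hy⟩ := exists_int_rounding h𝒜' hℬ' (fun s => by simp [𝒜']) fun _ => (1 / n : ℝ)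
  have hn1 : (1 : ℝ) ≤ n := by exact_mod_cast hn
  have hy01 : ∀ s, y s = if y s = 1 then 1 else 0 := by
    intro s
    have h := hy {s} (by simp [𝒜'])
    simp only [sum_singleton] at h
    have h0 : (0 : ℤ) ≤ ⌊(1 / n : ℝ)⌋ := Int.floor_nonneg.2 (by positivity)
    have h1 : ⌈(1 / n : ℝ)⌉ ≤ 1 := Int.ceil_le.2 (by
      rw [Int.cast_one, div_le_one (by linarith)]
      exact hn1)
    split_ifs <;> omega
  refine ⟨univ.filter fun s => y s = 1, fun P hP => ?_⟩
  have h := hy P (by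
    rcases hP with hP | hP
    · exact mem_union_left _ (by simp [𝒜', hP])
    · exact mem_union_right _ (by simp [ℬ', hP]))
  have hsum : ∑ s ∈ P, y s = (#(P ∩ univ.filter fun s => y s = 1) : ℤ) := by
    rw [sum_congr rfl fun s _ => hy01 s, sum_boole, ← filter_mem_eq_inter]
    simp only [mem_filter, mem_univ, true_and]
  rw [hsum, sum_const, nsmul_eq_mul, mul_one_div] at h
  have hnpos : (0 : ℝ) < n := by linarith
  have hfl := (Int.floor_lt (z := (#(P ∩ univ.filter fun s => y s = 1) : ℤ) + 1)).1
    (Int.lt_add_one_iff.2 h.1)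
  have hce := (Int.lt_ceil (z := (#(P ∩ univ.filter fun s => y s = 1) : ℤ) - 1)).1
    (Int.sub_one_lt_iff.2 h.2)
  rw [div_lt_iff₀ hnpos] at hfl
  rw [lt_div_iff₀ hnpos] at hce
  push_cast at hfl hce
  constructor
  · have : (n * #(P ∩ univ.filter fun s => y s = 1) : ℝ) < #P + n := by linarith
    exact_mod_cast this
  · have : (#P : ℝ) < n * #(P ∩ univ.filter fun s => y s = 1) + n := by linarith
    exact_mod_cast this

end IsLaminar

/-! ### Fair shares -/

/-- `a'` out of `b'` is as fair a share as `a` out of `b`: every integer bound on the ratio `a / b`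
also holds for `a' / b'`. Bounds are cross-multiplied, so that `b = 0` and `b' = 0` are meaningful:
if `a = b = 0` and `b' = 0` then `a' = 0`. -/
def SharesFairly (a b a' b' : ℕ) : Prop :=
  ∀ n : ℕ, (n * b ≤ a → n * b' ≤ a') ∧ (a ≤ n * b → a' ≤ n * b')

namespace SharesFairly

theorem refl (a b : ℕ) : SharesFairly a b a b := fun _ => ⟨id, id⟩

theorem trans {a b a' b' a'' b'' : ℕ} (h : SharesFairly a b a' b')
    (h' : SharesFairly a' b' a'' b'') : SharesFairly a b a'' b'' :=
  fun n => ⟨fun hn => (h' n).1 ((h n).1 hn), fun hn => (h' n).2 ((h n).2 hn)⟩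

theorem zero (a b : ℕ) : SharesFairly a b 0 0 := fun _ => by simp

/-- Rounding `c * m / g` to `z` is fair if the weights are in the proportion `c / g`. -/
theorem of_rounding {g c m z a b : ℕ} (h₁ : g * z < c * m + g) (h₂ : c * m < g * z + g)
    (hab : g * b = c * a) : SharesFairly m a z b := by
  intro n
  have hn : g * (n * b) = c * (n * a) := by rw [mul_left_comm, hab, mul_left_comm]
  constructor
  · intro h
    have h3 : c * (n * a) ≤ c * m := Nat.mul_le_mul_left _ h
    have h4 : g * (n * b) < g * (z + 1) := by rw [mul_add, mul_one]; omega
    exact Nat.lt_succ_iff.1 (lt_of_mul_lt_mul_left h4 (Nat.zero_le _))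
  · intro h
    have h3 : c * m ≤ c * (n * a) := Nat.mul_le_mul_left _ h
    have h4 : g * z < g * (n * b + 1) := by rw [mul_add, mul_one]; omega
    exact Nat.lt_succ_iff.1 (lt_of_mul_lt_mul_left h4 (Nat.zero_le _))

/-- The share complementary to that of `of_rounding`. -/
theorem of_rounding_compl {g c m z y a b : ℕ} (h₁ : g * z < c * m + g) (h₂ : c * m < g * z + g)
    (hc : c ≤ g) (hzy : y + z = m) (hab : g * b = (g - c) * a) : SharesFairly m a y b := by
  obtain ⟨c', rfl⟩ := Nat.exists_eq_add_of_le hc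
  rw [Nat.add_sub_cancel_left] at hab
  subst hzy
  refine of_rounding (g := c + c') (c := c') ?_ ?_ hab <;> nlinarith

end SharesFairly

/-! ### Types of hyperedges, their multiplicities and weights -/

section Counting

variable {V : Type*} {W : Type*} {E : Type*} {H : Type*}
  [Fintype V] [DecidableEq V] [Fintype W] [DecidableEq W]
  [Fintype E] [DecidableEq E] [Fintype H] [DecidableEq H]

/-- The number of hinges of the hyperedge `e` at each vertex. -/
def edgeType (φ : H → E) (ψ : H → V) (e : E) (x : V) : ℕ := #{h | φ h = e ∧ ψ h = x}

/-- The number of hyperedges in `D` of type `s`. -/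
def typeMult (φ : H → E) (ψ : H → V) (D : Finset E) (s : V → ℕ) : ℕ :=
  #{e ∈ D | edgeType φ ψ e = s}

/-- The hinges at the vertex `x` that belong to hyperedges in `D`. -/
def hingesIn (φ : H → E) (ψ : H → V) (D : Finset E) (x : V) : Finset H := {h | φ h ∈ D ∧ ψ h = x}

/-- The number of sets of vertices of type `s` in a blow-up in which `x` is replaced by `g x`
vertices, that is, of sets with `s x` elements above every `x`. -/
def typeWeight (g s : V → ℕ) : ℕ := ∏ x, (g x).choose (s x)

/-- The image of a function `s`, viewed as a multiset of vertices, under `Ψ`. -/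
def pushforward (Ψ : W → V) (s : W → ℕ) (x : V) : ℕ := ∑ u with Ψ u = x, s u

theorem pushforward_id (s : V → ℕ) : pushforward id s = s := by
  funext x
  simp [pushforward, filter_eq']

omit [Fintype V] in
theorem pushforward_comp {U : Type*} [Fintype U] [DecidableEq U] (Ψ : W → V) (Ψ' : U → W)
    (s : U → ℕ) : pushforward (Ψ ∘ Ψ') s = pushforward Ψ (pushforward Ψ' s) := by
  funext x
  simp only [pushforward, Function.comp_apply]
  rw [← sum_fiberwise_of_maps_to (t := univ.filter fun w => Ψ w = x) (g := Ψ') (by simp)]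
  refine sum_congr rfl fun w hw => sum_congr ?_ fun _ _ => rfl
  ext u
  simp only [mem_filter, mem_univ, true_and] at hw ⊢
  exact ⟨fun h => h.2, fun h => ⟨by rw [h, hw], h⟩⟩

omit [Fintype V] [Fintype E] [DecidableEq H] in
theorem edgeType_comp (φ : H → E) (Ψ : W → V) (ψ : H → W) (e : E) :
    edgeType φ (Ψ ∘ ψ) e = pushforward Ψ (edgeType φ ψ e) := by
  funext x
  simp only [edgeType, pushforward, Function.comp_apply]
  rw [card_eq_sum_card_fiberwise (t := univ.filter fun w => Ψ w = x) (f := ψ)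
    (fun h hh => by simpa using (mem_filter.1 hh).2.2)]
  refine sum_congr rfl fun w hw => congrArg card ?_
  ext h
  simp only [mem_filter, mem_univ, true_and] at hw ⊢
  exact ⟨fun h => ⟨h.1.1, h.2⟩, fun h => ⟨⟨h.1, by rw [h.2, hw]⟩, h.2⟩⟩

/-- `(ψ', g')` refines `(ψ, g)` along `Ψ`: the hinge incidences and the numbers of vertices still to
be created are compatible, and all degrees and multiplicities, in the whole hypergraph and in every
class of `𝒞`, are shared fairly. -/
structure IsFairDetachment (φ : H → E) (𝒞 : Set (Finset E)) (ψ : H → V) (g : V → ℕ)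
    (ψ' : H → W) (g' : W → ℕ) (Ψ : W → V) : Prop where
  comp : ψ = Ψ ∘ ψ'
  fiber : g = pushforward Ψ g'
  degree : ∀ D ∈ insert univ 𝒞, ∀ u,
    SharesFairly #(hingesIn φ ψ D (Ψ u)) (g (Ψ u)) #(hingesIn φ ψ' D u) (g' u)
  mult : ∀ D ∈ insert univ 𝒞, ∀ s,
    SharesFairly (typeMult φ ψ D (pushforward Ψ s)) (typeWeight g (pushforward Ψ s))
      (typeMult φ ψ' D s) (typeWeight g' s)

namespace IsFairDetachment

omit [DecidableEq H] in
theorem refl (φ : H → E) (𝒞 : Set (Finset E)) (ψ : H → V) (g : V → ℕ) :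
    IsFairDetachment φ 𝒞 ψ g ψ g id where
  comp := rfl
  fiber := (pushforward_id g).symm
  degree _ _ _ := .refl _ _
  mult _ _ s := by
    rw [pushforward_id]
    exact .refl _ _

omit [DecidableEq H] in
theorem trans {U : Type*} [Fintype U] [DecidableEq U] {φ : H → E} {𝒞 : Set (Finset E)}
    {ψ : H → V} {g : V → ℕ} {ψ' : H → W} {g' : W → ℕ} {Ψ : W → V} {ψ'' : H → U} {g'' : U → ℕ}
    {Ψ' : U → W} (h : IsFairDetachment φ 𝒞 ψ g ψ' g' Ψ)
    (h' : IsFairDetachment φ 𝒞 ψ' g' ψ'' g'' Ψ') :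
    IsFairDetachment φ 𝒞 ψ g ψ'' g'' (Ψ ∘ Ψ') where
  comp := by rw [h.comp, h'.comp, Function.comp_assoc]
  fiber := by rw [h.fiber, h'.fiber, pushforward_comp]
  degree D hD u := (h.degree D hD (Ψ' u)).trans (h'.degree D hD u)
  mult D hD s := by
    rw [pushforward_comp]
    exact (h.mult D hD _).trans (h'.mult D hD s)

omit [DecidableEq H] in
/-- The upper bounds on the multiplicities carry over the condition that every hyperedge has a type
of positive weight. -/
theorem typeWeight_pos {φ : H → E} {𝒞 : Set (Finset E)}
    {ψ : H → V} {g : V → ℕ} {ψ' : H → W} {g' : W → ℕ} {Ψ : W → V}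
    (h : IsFairDetachment φ 𝒞 ψ g ψ' g' Ψ) (hw : ∀ e, 0 < typeWeight g (edgeType φ ψ e)) (e : E) :
    0 < typeWeight g' (edgeType φ ψ' e) := by
  have h1 := h.mult univ (Set.mem_insert _ _) (edgeType φ ψ' e)
  rw [← edgeType_comp, ← h.comp] at h1
  have h2 := (h1 _).2 (Nat.le_mul_of_pos_right _ (hw e))
  have h3 : 0 < typeMult φ ψ' univ (edgeType φ ψ' e) := card_pos.2 ⟨e, by simp⟩
  exact Nat.pos_of_mul_pos_left (h3.trans_le h2)

end IsFairDetachment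

/-! ### Equitable sets of hinges -/

omit [Fintype V] [Fintype E] [DecidableEq H] in
theorem mem_hingesIn {φ : H → E} {ψ : H → V} {D : Finset E} {x : V} {h : H} :
    h ∈ hingesIn φ ψ D x ↔ φ h ∈ D ∧ ψ h = x := by
  simp [hingesIn]

omit [Fintype V] [Fintype E] in
theorem card_hingesIn_inter (φ : H → E) (ψ : H → V) (D : Finset E) (x : V) (Z : Finset H) :
    #(hingesIn φ ψ D x ∩ Z) = ∑ e ∈ D, #(hingesIn φ ψ {e} x ∩ Z) := by
  rw [card_eq_sum_card_fiberwise (t := D) (f := φ)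
    (fun h hh => by simpa using (mem_filter.1 (mem_inter.1 hh).1).2.1)]
  refine sum_congr rfl fun e he => congrArg card ?_
  ext h
  simp only [hingesIn, mem_filter, mem_inter, mem_univ, true_and, mem_singleton]
  exact ⟨fun h => ⟨⟨h.2, h.1.1.2⟩, h.1.2⟩, fun h => ⟨⟨⟨h.1.1 ▸ he, h.1.2⟩, h.2⟩, h.1.1⟩⟩

omit [Fintype V] [Fintype E] [DecidableEq H] in
theorem card_hingesIn_singleton (φ : H → E) (ψ : H → V) (e : E) (x : V) :
    #(hingesIn φ ψ {e} x) = edgeType φ ψ e x := by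
  simp [hingesIn, edgeType]

omit [Fintype E] in
theorem card_hingesIn_filter_edgeType (φ : H → E) (ψ : H → V) (D : Finset E) (x : V) (s : V → ℕ) :
    #(hingesIn φ ψ {e ∈ D | edgeType φ ψ e = s} x) = s x * typeMult φ ψ D s := by
  have h := card_hingesIn_inter φ ψ {e ∈ D | edgeType φ ψ e = s} x univ
  simp only [inter_univ, card_hingesIn_singleton] at h
  rw [h, sum_congr rfl fun e he => by rw [(mem_filter.1 he).2], sum_const, smul_eq_mul, mul_comm,
    typeMult]

omit [Fintype V] [Fintype E] [DecidableEq H] in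
theorem hingesIn_isLaminar (φ : H → E) (ψ : H → V) (x : V) {𝒜 : Set (Finset E)}
    (h𝒜 : IsLaminar 𝒜) : IsLaminar ((fun D => hingesIn φ ψ D x) '' 𝒜) := by
  rintro _ ⟨P, hP, rfl⟩ _ ⟨Q, hQ, rfl⟩
  have hmono : ∀ {P Q : Finset E}, P ⊆ Q → hingesIn φ ψ P x ⊆ hingesIn φ ψ Q x :=
    fun h a ha => by
      simp only [hingesIn, mem_filter, mem_univ, true_and] at ha ⊢
      exact ⟨h ha.1, ha.2⟩
  rcases h𝒜 P hP Q hQ with h | h | h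
  · exact .inl (hmono h)
  · exact .inr (.inl (hmono h))
  · refine .inr (.inr (Finset.disjoint_left.2 fun a ha ha' => ?_))
    exact Finset.disjoint_left.1 h (mem_filter.1 ha).2.1 (mem_filter.1 ha').2.1

/-- A set of hinges at `x` that contains, up to rounding, the proportion `1 / n` of the hinges at
`x` of each type, in the whole hypergraph and in every class, as well as of the hinges joining `x` to
each single hyperedge. -/
theorem exists_equitable_hinges (φ : H → E) (ψ : H → V) {𝒞 : Set (Finset E)}
    (h𝒞 : 𝒞.PairwiseDisjoint id) (x : V) {n : ℕ} (hn : 0 < n) :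
    ∃ Z : Finset H, ∀ D : Finset E,
      (D ∈ insert univ 𝒞 ∨ (∃ D' ∈ insert univ 𝒞, ∃ s, D = {e ∈ D' | edgeType φ ψ e = s}) ∨
        ∃ e, D = {e}) →
      n * #(hingesIn φ ψ D x ∩ Z) < #(hingesIn φ ψ D x) + n ∧
        #(hingesIn φ ψ D x) < n * #(hingesIn φ ψ D x ∩ Z) + n := by
  -- the types within a class, the classes, and everything; single hyperedges are at the bottom
  let 𝒜 : Set (Finset E) := {D | D = univ ∨ (∃ e, D = {e}) ∨
    ∃ C ∈ 𝒞, D = C ∨ ∃ s, D = {e ∈ C | edgeType φ ψ e = s}}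
  let ℬ : Set (Finset E) := {D | ∃ s, D = ({e | edgeType φ ψ e = s} : Finset E)}
  have hdisj : ∀ (C C' : Finset E) (s s' : V → ℕ), s ≠ s' →
      Disjoint {e ∈ C | edgeType φ ψ e = s} {e ∈ C' | edgeType φ ψ e = s'} :=
    fun C C' s s' hne => Finset.disjoint_left.2 fun e he he' =>
      hne ((mem_filter.1 he).2.symm.trans (mem_filter.1 he').2)
  have hsub : ∀ {C D : Finset E}, (D = C ∨ ∃ s, D = {e ∈ C | edgeType φ ψ e = s}) → D ⊆ C := by
    rintro C D (rfl | ⟨s, rfl⟩)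
    · exact Subset.rfl
    · exact filter_subset _ _
  have hsingle : ∀ (e : E) (Q : Finset E), {e} ⊆ Q ∨ Disjoint {e} Q := fun e Q => by
    rw [singleton_subset_iff, disjoint_singleton_left]
    exact em _
  have h𝒜 : IsLaminar 𝒜 := by
    rintro P (rfl | ⟨e, rfl⟩ | ⟨C, hC, hP⟩) Q hQ
    · exact .inr (.inl (subset_univ _))
    · exact (hsingle e Q).imp_right .inr
    · rcases hQ with rfl | ⟨e, rfl⟩ | ⟨C', hC', hQ⟩
      · exact .inl (subset_univ _)
      · exact .inr ((hsingle e P).imp_right fun h => h.symm)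
      · by_cases hCC : C = C'
        · subst hCC
          rcases hP with rfl | ⟨s, rfl⟩
          · exact .inr (.inl (hsub hQ))
          · rcases hQ with rfl | ⟨s', rfl⟩
            · exact .inl (filter_subset _ _)
            · by_cases hs : s = s'
              · exact .inl (by rw [hs])
              · exact .inr (.inr (hdisj _ _ _ _ hs))
        · exact .inr (.inr ((h𝒞 hC hC' hCC).mono (hsub hP) (hsub hQ)))
  have hℬ : IsLaminar ℬ := by
    rintro _ ⟨s, rfl⟩ _ ⟨s', rfl⟩
    by_cases hs : s = s'
    · exact .inl (by rw [hs])
    · exact .inr (.inr (hdisj _ _ _ _ hs))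
  obtain ⟨Z, hZ⟩ := IsLaminar.exists_equitable_subset (hingesIn_isLaminar φ ψ x h𝒜)
    (hingesIn_isLaminar φ ψ x hℬ) hn
  refine ⟨Z, fun D hD => hZ _ ?_⟩
  rw [← Set.image_union]
  refine Set.mem_image_of_mem (fun D => hingesIn φ ψ D x) ?_
  rcases hD with (hD | hD) | ⟨D', hD' | hD', s, hD⟩ | hD
  · exact .inl (.inl hD)
  · exact .inl (.inr (.inr ⟨D, hD, .inl rfl⟩))
  · exact .inr ⟨s, by rw [hD, hD']⟩
  · exact .inl (.inr (.inr ⟨D', hD', .inr ⟨s, hD⟩⟩))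
  · exact .inl (.inr (.inl hD))

/-! ### Splitting off one vertex -/

/-- Moving the hinges in `Z` from the vertex `x` to the new vertex `none`. -/
def splitVertex (ψ : H → V) (x : V) (Z : Finset H) (h : H) : Option V :=
  if ψ h = x ∧ h ∈ Z then none else some (ψ h)

/-- One of the `g x` vertices that are to replace `x` becomes the new vertex `none`. -/
def splitNumber (g : V → ℕ) (x : V) (o : Option V) : ℕ :=
  o.elim 1 (Function.update g x (g x - 1))

omit [Fintype V] [Fintype H] in
theorem getD_comp_splitVertex (ψ : H → V) (x : V) (Z : Finset H) :
    (fun o : Option V => o.getD x) ∘ splitVertex ψ x Z = ψ := by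
  funext h
  simp only [Function.comp_apply, splitVertex]
  split_ifs with hh
  · exact hh.1.symm
  · rfl

theorem pushforward_getD (x : V) (s : Option V → ℕ) (y : V) :
    pushforward (fun o : Option V => o.getD x) s y = s (some y) + if y = x then s none else 0 := by
  rw [pushforward, sum_filter, Fintype.sum_option, add_comm]
  simp [eq_comm]

omit [Fintype V] [Fintype E] in
theorem hingesIn_splitVertex_none (φ : H → E) (ψ : H → V) (x : V) (Z : Finset H) (D : Finset E) :
    hingesIn φ (splitVertex ψ x Z) D none = hingesIn φ ψ D x ∩ Z := by
  ext h
  simp [hingesIn, splitVertex, and_assoc]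

omit [Fintype V] [Fintype E] in
theorem hingesIn_splitVertex_some (φ : H → E) (ψ : H → V) (x : V) (Z : Finset H) (D : Finset E)
    (y : V) : hingesIn φ (splitVertex ψ x Z) D (some y) =
      if y = x then hingesIn φ ψ D x \ Z else hingesIn φ ψ D y := by
  ext h
  split_ifs with hy
  · subst hy
    rw [mem_sdiff, mem_hingesIn, mem_hingesIn, splitVertex]
    split_ifs with hh
    · simp [hh.2]
    · simp only [Option.some.injEq]
      tauto
  · rw [mem_hingesIn, mem_hingesIn, splitVertex]
    split_ifs with hh
    · simp [hh.1, Ne.symm hy]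
    · simp

omit [Fintype E] in
/-- The type of a hyperedge after the splitting is determined by its type before and by the
number of its hinges that are moved. -/
theorem edgeType_splitVertex_eq_iff (φ : H → E) (ψ : H → V) (x : V) (Z : Finset H) (e : E)
    (s : Option V → ℕ) : edgeType φ (splitVertex ψ x Z) e = s ↔
      edgeType φ ψ e = pushforward (fun o : Option V => o.getD x) s ∧
        #(hingesIn φ ψ {e} x ∩ Z) = s none := by
  have h1 := edgeType_comp φ (fun o : Option V => o.getD x) (splitVertex ψ x Z) e
  rw [getD_comp_splitVertex] at h1
  have h2 : edgeType φ (splitVertex ψ x Z) e none = #(hingesIn φ ψ {e} x ∩ Z) := by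
    rw [← card_hingesIn_singleton, hingesIn_splitVertex_none]
  constructor
  · rintro rfl
    exact ⟨h1, h2.symm⟩
  · rintro ⟨h3, h4⟩
    rw [h1] at h3
    funext o
    cases o with
    | none => rw [h2, h4]
    | some y =>
      have h5 := congrFun h3 y
      rw [pushforward_getD, pushforward_getD, h2, h4] at h5
      exact Nat.add_right_cancel h5

theorem typeWeight_splitNumber (g : V → ℕ) (x : V) (s : Option V → ℕ) :
    typeWeight (splitNumber g x) s =
      Nat.choose 1 (s none) * ((g x - 1).choose (s (some x)) *
        ∏ y ∈ univ.erase x, (g y).choose (s (some y))) := by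
  rw [typeWeight, Fintype.prod_option, ← mul_prod_erase univ _ (mem_univ x)]
  simp only [splitNumber, Option.elim_none, Option.elim_some, Function.update_self]
  congr 2
  exact prod_congr rfl fun y hy => by rw [Function.update_of_ne (ne_of_mem_erase hy)]

theorem typeWeight_pushforward_getD (g : V → ℕ) (x : V) (s : Option V → ℕ) :
    typeWeight g (pushforward (fun o : Option V => o.getD x) s) =
      (g x).choose (s (some x) + s none) * ∏ y ∈ univ.erase x, (g y).choose (s (some y)) := by
  rw [typeWeight, ← mul_prod_erase univ _ (mem_univ x), pushforward_getD, if_pos rfl]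
  congr 1
  refine prod_congr rfl fun y hy => ?_
  rw [pushforward_getD, if_neg (ne_of_mem_erase hy), add_zero]

omit [DecidableEq V] in
theorem le_of_typeWeight_pos {g s : V → ℕ} (h : 0 < typeWeight g s) (x : V) : s x ≤ g x := by
  by_contra hlt
  rw [typeWeight, prod_eq_zero (mem_univ x) (Nat.choose_eq_zero_of_lt (not_le.1 hlt))] at h
  exact lt_irrefl _ h

/-- One vertex can be split off fairly. -/
theorem exists_isFairDetachment_splitVertex (φ : H → E) (ψ : H → V) {𝒞 : Set (Finset E)}
    (h𝒞 : 𝒞.PairwiseDisjoint id) {g : V → ℕ} (hw : ∀ e, 0 < typeWeight g (edgeType φ ψ e))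
    {x : V} (hx : 0 < g x) :
    ∃ Z : Finset H, IsFairDetachment φ 𝒞 ψ g (splitVertex ψ x Z) (splitNumber g x)
      (fun o : Option V => o.getD x) := by
  obtain ⟨Z, hZ⟩ := exists_equitable_hinges φ ψ h𝒞 x hx
  -- `edgeType φ ψ e x ≤ g x`, so at most one hinge of each hyperedge is moved
  have hone : ∀ e, #(hingesIn φ ψ {e} x ∩ Z) ≤ 1 := by
    intro e
    have h := (hZ {e} (.inr (.inr ⟨e, rfl⟩))).1
    rw [card_hingesIn_singleton] at h
    have h2 := le_of_typeWeight_pos (hw e) x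
    by_contra hlt
    have h3 : g x * 2 ≤ g x * #(hingesIn φ ψ {e} x ∩ Z) := Nat.mul_le_mul_left _ (by omega)
    omega
  refine ⟨Z, (getD_comp_splitVertex ψ x Z).symm, ?_, ?_, ?_⟩
  · funext y
    rw [pushforward_getD]
    by_cases hy : y = x
    · subst hy
      simp [splitNumber]
      omega
    · simp [splitNumber, hy]
  · intro D hD o
    obtain ⟨h1, h2⟩ := hZ D (.inl hD)
    cases o with
    | none =>
      rw [hingesIn_splitVertex_none]
      exact .of_rounding (g := g x) (c := 1) (by simpa using h1) (by simpa using h2)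
        (by simp [splitNumber])
    | some y =>
      rw [hingesIn_splitVertex_some]
      by_cases hy : y = x
      · subst hy
        rw [if_pos rfl]
        exact .of_rounding_compl (g := g y) (c := 1) (by simpa using h1) (by simpa using h2)
          hx (card_sdiff_add_card_inter _ _) (by simp [splitNumber, mul_comm])
      · rw [if_neg hy]
        simpa [splitNumber, hy] using SharesFairly.refl _ _
  · intro D hD s
    set t := pushforward (fun o : Option V => o.getD x) s with ht
    obtain ⟨h1, h2⟩ := hZ _ (.inr (.inl ⟨D, hD, t, rfl⟩))
    rw [card_hingesIn_filter_edgeType, card_hingesIn_inter] at h1 h2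
    have htx : t x = s (some x) + s none := by rw [ht, pushforward_getD, if_pos rfl]
    have hmult : typeMult φ (splitVertex ψ x Z) D s =
        #{e ∈ {e ∈ D | edgeType φ ψ e = t} | #(hingesIn φ ψ {e} x ∩ Z) = s none} := by
      rw [typeMult, filter_filter]
      simp only [edgeType_splitVertex_eq_iff, ht]
    have hmoved : ∑ e ∈ D with edgeType φ ψ e = t, #(hingesIn φ ψ {e} x ∩ Z) =
        #{e ∈ {e ∈ D | edgeType φ ψ e = t} | #(hingesIn φ ψ {e} x ∩ Z) = 1} := by
      rw [card_filter]
      refine sum_congr rfl fun e _ => ?_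
      have := hone e
      split_ifs <;> omega
    rw [hmoved] at h1 h2
    rw [typeWeight_splitNumber, ht, typeWeight_pushforward_getD, ← ht, hmult]
    set R := ∏ y ∈ univ.erase x, (g y).choose (s (some y))
    rcases Nat.lt_or_ge 1 (s none) with hs | hs
    · -- two hinges of a hyperedge never go to the same new vertex
      rw [filter_false_of_mem fun e _ => by have := hone e; omega, Nat.choose_eq_zero_of_lt hs,
        zero_mul, card_empty]
      exact .zero _ _
    · obtain ⟨n, hn⟩ : ∃ n, g x = n + 1 := ⟨g x - 1, by omega⟩
      rw [hn] at h1 h2 ⊢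
      rw [Nat.add_sub_cancel]
      rcases Nat.le_one_iff_eq_zero_or_eq_one.1 hs with hs | hs
      · rw [hs] at htx ⊢
        rw [add_zero] at htx ⊢
        rw [htx] at h1 h2
        rw [Nat.choose_zero_right, one_mul]
        have hsplit : #{e ∈ {e ∈ D | edgeType φ ψ e = t} | #(hingesIn φ ψ {e} x ∩ Z) = 0} +
            #{e ∈ {e ∈ D | edgeType φ ψ e = t} | #(hingesIn φ ψ {e} x ∩ Z) = 1} =
            typeMult φ ψ D t := by
          rw [typeMult, ← card_filter_add_card_filter_not (s := {e ∈ D | edgeType φ ψ e = t})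
            fun e => #(hingesIn φ ψ {e} x ∩ Z) = 0]
          congr 2
          refine filter_congr fun e _ => ?_
          have := hone e
          omega
        rcases Nat.lt_or_ge (n + 1) (s (some x)) with hlt | hle
        · -- no hyperedge has more than `g x` hinges at `x`
          rw [Nat.choose_eq_zero_of_lt (show n < s (some x) by omega), zero_mul]
          have h0 : typeMult φ ψ D t = 0 := by
            rw [typeMult, card_eq_zero]
            refine filter_false_of_mem fun e _ he => ?_
            have := le_of_typeWeight_pos (hw e) x
            rw [he] at this
            omega
          rw [show #{e ∈ {e ∈ D | edgeType φ ψ e = t} | #(hingesIn φ ψ {e} x ∩ Z) = 0} = 0 by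
            omega]
          exact .zero _ _
        · refine .of_rounding_compl h1 h2 hle hsplit ?_
          rw [← mul_assoc, ← mul_assoc, mul_comm (n + 1), mul_comm (n + 1 - _),
            Nat.choose_mul_succ_eq]
      · rw [hs] at htx ⊢
        rw [htx] at h1 h2
        rw [Nat.choose_self, one_mul]
        refine .of_rounding h1 h2 ?_
        rw [← mul_assoc, ← mul_assoc, mul_comm (s (some x) + 1), Nat.add_one_mul_choose_eq]

end Counting

theorem sum_splitNumber {V : Type*} [Fintype V] [DecidableEq V] (g : V → ℕ) {x : V}
    (hx : 0 < g x) : ∑ o, splitNumber g x o = ∑ y, g y := by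
  rw [Fintype.sum_option, ← add_sum_erase univ _ (mem_univ x),
    ← add_sum_erase univ g (mem_univ x)]
  simp only [splitNumber, Option.elim_none, Option.elim_some, Function.update_self]
  rw [sum_congr rfl fun y hy => Function.update_of_ne (ne_of_mem_erase hy) _ _]
  omega

/-- Splitting off vertices one at a time ends when all numbers are `1`. -/
theorem exists_isFairDetachment_one {E : Type v} {H : Type w} [Fintype E] [DecidableEq E]
    [Fintype H] [DecidableEq H] (φ : H → E) {𝒞 : Set (Finset E)} (h𝒞 : 𝒞.PairwiseDisjoint id)
    (N : ℕ) : ∀ (V : Type u) [Fintype V] [DecidableEq V] (ψ : H → V) (g : V → ℕ),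
      (∀ x, 0 < g x) → (∀ e, 0 < typeWeight g (edgeType φ ψ e)) →
      ∑ x, g x = Fintype.card V + N →
      ∃ (W : Type u) (_ : Fintype W) (_ : DecidableEq W) (ψ' : H → W) (Ψ : W → V),
        IsFairDetachment φ 𝒞 ψ g ψ' (fun _ => 1) Ψ := by
  induction N with
  | zero =>
    intro V _ _ ψ g hg _ hN
    have h1 : ∀ x ∈ univ, 1 = g x :=
      (sum_eq_sum_iff_of_le fun x _ => hg x).1 (by simpa using hN.symm)
    have hg1 : g = fun _ => 1 := funext fun x => (h1 x (mem_univ x)).symm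
    subst hg1
    exact ⟨V, inferInstance, inferInstance, ψ, id, .refl _ _ _ _⟩
  | succ N ih =>
    intro V _ _ ψ g hg hw hN
    obtain ⟨x, hx⟩ : ∃ x, 1 < g x := by
      by_contra! h
      have : ∑ x, g x ≤ ∑ _x : V, 1 := sum_le_sum fun x _ => h x
      rw [sum_const, card_univ, smul_eq_mul, mul_one] at this
      omega
    obtain ⟨Z, hZ⟩ := exists_isFairDetachment_splitVertex φ ψ h𝒞 hw (hg x)
    obtain ⟨W, _, _, ψ', Ψ, h⟩ := ih (Option V) (splitVertex ψ x Z) (splitNumber g x)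
      (fun o => by
        cases o with
        | none => exact Nat.one_pos
        | some y =>
          by_cases hy : y = x
          · subst hy
            simp [splitNumber]
            omega
          · simpa [splitNumber, hy] using hg y)
      (hZ.typeWeight_pos hw)
      (by rw [sum_splitNumber g (hg x), hN, Fintype.card_option]; omega)
    exact ⟨W, inferInstance, inferInstance, ψ', _, hZ.trans h⟩

/-! ### Hypergraphs with three hinges on every hyperedge -/

/-- The type of a hyperedge whose three hinges are at `x`, `y` and `z`. -/
def tripleType {V : Type*} [DecidableEq V] (x y z : V) : V → ℕ :=
  Pi.single x 1 + Pi.single y 1 + Pi.single z 1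

theorem pushforward_tripleType {V W : Type*} [DecidableEq V] [Fintype W] [DecidableEq W]
    (Ψ : W → V) (x y z : W) :
    pushforward Ψ (tripleType x y z) = tripleType (Ψ x) (Ψ y) (Ψ z) := by
  funext a
  simp [pushforward, tripleType, sum_add_distrib, Pi.single_apply, eq_comm]

theorem gTilde_eq_typeWeight {V : Type*} [Fintype V] [DecidableEq V] (g : V → ℕ) (x y z : V) :
    gTilde g x y z = typeWeight g (tripleType x y z) := by
  have h : typeWeight g (tripleType x y z) =
      ∏ a ∈ {x, y, z}, (g a).choose (tripleType x y z a) := by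
    refine (prod_subset (subset_univ _) fun a _ ha => ?_).symm
    simp only [mem_insert, mem_singleton, not_or] at ha
    simp [tripleType, ha.1, ha.2.1, ha.2.2]
  rw [h, gTilde]
  by_cases hxy : x = y
  · subst hxy
    by_cases hxz : x = z
    · subst hxz
      simp [tripleType]
    · simp [tripleType, hxz, Ne.symm hxz, prod_insert]
  · by_cases hxz : x = z
    · subst hxz
      simp [tripleType, hxy, Ne.symm hxy, prod_insert, mul_comm]
    · by_cases hyz : y = z
      · subst hyz
        simp [tripleType, hxy, Ne.symm hxy, prod_insert, mul_comm]
      · simp [tripleType, hxy, hxz, hyz, Ne.symm hxy, Ne.symm hxz, Ne.symm hyz, prod_insert,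
          mul_assoc]

theorem RoundsTo.of_sharesFairly {a b c : ℕ} (h : SharesFairly a b c 1) (h0 : b = 0 → a = 0) :
    RoundsTo c ((a : ℝ) / (b : ℝ)) := by
  rcases Nat.eq_zero_or_pos b with hb | hb
  · have hc := (h 0).2 (by simp [h0 hb])
    simp only [zero_mul, Nat.le_zero] at hc
    simp [RoundsTo, hb, hc]
  · have hb' : (0 : ℝ) < b := by exact_mod_cast hb
    have hnn : (0 : ℝ) ≤ (a : ℝ) / b := by positivity
    constructor
    · rw [← natCast_floor_eq_intCast_floor hnn, Nat.cast_le, ← mul_one ⌊(a : ℝ) / b⌋₊]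
      refine (h _).1 ?_
      have := Nat.floor_le hnn
      rw [le_div_iff₀ hb'] at this
      exact_mod_cast this
    · rw [← natCast_ceil_eq_intCast_ceil hnn, Nat.cast_le, ← mul_one ⌈(a : ℝ) / b⌉₊]
      refine (h _).2 ?_
      have := Nat.le_ceil ((a : ℝ) / b)
      rw [div_le_iff₀ hb'] at this
      exact_mod_cast this

namespace HingedHypergraph

variable {V : Type u} {E : Type v} {H : Type w} [DecidableEq V] [Fintype E] [DecidableEq E]
  [Fintype H]

theorem degree_eq (G : HingedHypergraph V E H) (x : V) :
    G.degree x = #(hingesIn G.φ G.ψ univ x) := by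
  rw [degree, ← Set.ncard_coe_finset]
  congr 1
  ext h
  simp [hingesAtVertex, mem_hingesIn]

theorem degree_colorClass_eq (G : HingedHypergraph V E H) {k : ℕ} (K : E → Fin k) (j : Fin k)
    (x : V) : (G.colorClass K j).degree x = #(hingesIn G.φ G.ψ {e | K e = j} x) := by
  rw [degree, ← Set.ncard_coe_finset, ← Set.ncard_image_of_injective _ Subtype.val_injective]
  congr 1
  ext h
  simp only [hingesAtVertex, colorClass, Set.mem_image, Set.mem_preimage, Set.mem_singleton_iff,
    Subtype.exists, exists_and_left, exists_prop, exists_eq_right_right, mem_coe, mem_hingesIn,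
    mem_filter, mem_univ, true_and]
  tauto

omit [Fintype E] in
theorem mem_nabla_iff (G : HingedHypergraph V E H) (x y z : V) (e : E) :
    e ∈ G.nabla x y z ↔ edgeType G.φ G.ψ e = tripleType x y z := by
  classical
  set A : Finset H := univ.filter fun h => G.φ h = e with hA
  have hcount : ∀ a, edgeType G.φ G.ψ e a = #{h ∈ A | G.ψ h = a} := fun a => by
    rw [edgeType, hA, filter_filter]
  have hAset : G.hingesAtEdge e = (A : Set H) := by
    ext h
    simp [hingesAtEdge, hA]
  constructor
  · rintro ⟨h₁, h₂, h₃, h12, h13, h23, he, rfl, rfl, rfl⟩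
    have hA3 : A = {h₁, h₂, h₃} := by
      rw [← Finset.coe_inj, ← hAset, he]
      simp
    funext a
    rw [hcount, hA3, card_filter, sum_insert (by simp [h12, h13]), sum_insert (by simp [h23]),
      sum_singleton]
    simp [tripleType, Pi.single_apply, eq_comm, add_assoc]
  · intro h
    -- as multisets, the vertices of the hinges of `e` are `x`, `y`, `z`
    have hmap : A.val.map G.ψ = x ::ₘ y ::ₘ z ::ₘ 0 := by
      ext a
      have h1 : (A.val.map G.ψ).count a = #{h ∈ A | G.ψ h = a} := by
        simp only [Multiset.count_map, card_def, filter_val, @eq_comm _ a]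
      rw [h1, ← hcount, h]
      simp only [tripleType, Pi.add_apply, Pi.single_apply, Multiset.count_cons,
        Multiset.count_zero]
      ring
    obtain ⟨h₁, hh₁, hx, hmap₁⟩ := (Multiset.map_eq_cons _ _ _ _).2 hmap
    rw [← erase_val] at hmap₁
    obtain ⟨h₂, hh₂, hy, hmap₂⟩ := (Multiset.map_eq_cons _ _ _ _).2 hmap₁
    rw [← erase_val] at hmap₂
    obtain ⟨h₃, hh₃, hz, hmap₃⟩ := (Multiset.map_eq_cons _ _ _ _).2 hmap₂
    rw [← erase_val, Multiset.map_eq_zero, val_eq_zero] at hmap₃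
    rw [mem_val] at hh₁ hh₂ hh₃
    have h12 := (mem_erase.1 hh₂).1
    have h23 := (mem_erase.1 hh₃).1
    have h13 := (mem_erase.1 (mem_of_mem_erase hh₃)).1
    refine ⟨h₁, h₂, h₃, h12.symm, h13.symm, h23.symm, ?_, hx, hy, hz⟩
    rw [hAset, ← insert_erase hh₁, ← insert_erase hh₂, ← insert_erase hh₃, hmap₃]
    simp

theorem mult_eq (G : HingedHypergraph V E H) [Fintype V] (x y z : V) :
    G.mult x y z = typeMult G.φ G.ψ univ (tripleType x y z) := by
  rw [mult, typeMult, ← Set.ncard_coe_finset]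
  congr 1
  ext e
  simp [mem_nabla_iff]

omit [Fintype E] in
theorem edgeType_colorClass (G : HingedHypergraph V E H) {k : ℕ} (K : E → Fin k) (j : Fin k)
    (e : {e : E // K e = j}) :
    edgeType (G.colorClass K j).φ (G.colorClass K j).ψ e = edgeType G.φ G.ψ e.1 := by
  funext x
  refine card_bij (fun h _ => h.1) (fun h hh => ?_) (fun h _ h' _ => Subtype.ext) fun h hh => ?_
  · simpa [colorClass, Subtype.ext_iff] using hh
  · simp only [mem_filter, mem_univ, true_and] at hh
    refine ⟨⟨h, by rw [hh.1, e.2]⟩, ?_, rfl⟩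
    simp [colorClass, Subtype.ext_iff, hh.1, hh.2]

theorem mult_colorClass_eq (G : HingedHypergraph V E H) [Fintype V] {k : ℕ} (K : E → Fin k)
    (j : Fin k) (x y z : V) : (G.colorClass K j).mult x y z =
      typeMult G.φ G.ψ {e | K e = j} (tripleType x y z) := by
  rw [mult, typeMult, ← Set.ncard_coe_finset,
    ← Set.ncard_image_of_injective _ Subtype.val_injective]
  congr 1
  ext e
  simp only [Set.mem_image, mem_nabla_iff, edgeType_colorClass, Subtype.exists, exists_and_left,
    exists_prop, exists_eq_right_right, mem_coe, mem_filter, mem_univ, true_and]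
  tauto

theorem mult_right_comm (G : HingedHypergraph V E H) [Fintype V] (x y z : V) :
    G.mult x y z = G.mult x z y := by
  rw [mult_eq, mult_eq, tripleType, tripleType, add_right_comm]

theorem mult_rotate (G : HingedHypergraph V E H) [Fintype V] (x y z : V) :
    G.mult x y z = G.mult y z x := by
  rw [mult_eq, mult_eq, tripleType, tripleType, add_assoc, add_comm]

/-- The hypotheses on small values of `g` say that every hyperedge has a type of positive weight. -/
theorem typeWeight_edgeType_pos (F : HingedHypergraph V E H) [Fintype V]
    (hF : ∀ e : E, (F.hingesAtEdge e).ncard = 3) {g : V → ℕ} (hg : ∀ x : V, 0 < g x)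
    (hg2 : ∀ x : V, g x ≤ 2 → F.mult x x x = 0)
    (hg1 : ∀ x : V, g x = 1 → ∀ y : V, F.mult x x y = 0) (e : E) :
    0 < typeWeight g (edgeType F.φ F.ψ e) := by
  obtain ⟨h₁, h₂, h₃, h12, h13, h23, he⟩ := Set.ncard_eq_three.1 (hF e)
  have hmem : e ∈ F.nabla (F.ψ h₁) (F.ψ h₂) (F.ψ h₃) :=
    ⟨h₁, h₂, h₃, h12, h13, h23, he, rfl, rfl, rfl⟩
  have hpos : F.mult (F.ψ h₁) (F.ψ h₂) (F.ψ h₃) ≠ 0 :=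
    ((Set.ncard_pos (Set.toFinite _)).2 ⟨e, hmem⟩).ne'
  rw [(F.mem_nabla_iff _ _ _ _).1 hmem, ← gTilde_eq_typeWeight]
  generalize F.ψ h₁ = x, F.ψ h₂ = y, F.ψ h₃ = z at hpos
  have htwo : ∀ a b, F.mult a a b ≠ 0 → 0 < (g a).choose 2 * g b := fun a b hab =>
    mul_pos (Nat.choose_pos (by
      by_contra hlt
      exact hab (hg1 a (by have := hg a; omega) b))) (hg b)
  rw [gTilde]
  split_ifs with hxy hyz hxz hyz
  · subst hxy hyz
    exact Nat.choose_pos (by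
      by_contra hlt
      exact hpos (hg2 _ (by omega)))
  · subst hxy
    exact htwo _ _ hpos
  · subst hxz
    exact htwo _ _ (by rwa [mult_right_comm] at hpos)
  · subst hyz
    exact htwo _ _ (by rwa [mult_rotate] at hpos)
  · exact mul_pos (mul_pos (hg x) (hg y)) (hg z)

end HingedHypergraph

theorem theorem3p1 {V : Type u} {E : Type v} {H : Type w} [Finite V] [Finite E] [Finite H]
    (F : HingedHypergraph V E H)
    (hF : ∀ e : E, (F.hingesAtEdge e).ncard = 3)
    (k : ℕ) (K : E → Fin k)
    (g : V → ℕ) (hg : ∀ x : V, 0 < g x)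
    (hg2 : ∀ x : V, g x ≤ 2 → F.mult x x x = 0)
    (hg1 : ∀ x : V, g x = 1 → ∀ y : V, F.mult x x y = 0) :
    ∃ (W : Type u) (_ : Finite W) (G : HingedHypergraph W E H) (Ψ : W → V),
      G.IsUniform 3 ∧
      HingedHypergraph.IsDetachment g Ψ G F ∧
      (∀ (x : V) (u : W), Ψ u = x →
        RoundsTo (G.degree u) ((F.degree x : ℝ) / (g x : ℝ))) ∧
      (∀ (x : V) (u : W), Ψ u = x → ∀ j : Fin k,
        RoundsTo ((G.colorClass K j).degree u)
          (((F.colorClass K j).degree x : ℝ) / (g x : ℝ))) ∧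
      (∀ (x y z : V) (u v w : W), u ≠ v → u ≠ w → v ≠ w → Ψ u = x → Ψ v = y → Ψ w = z →
        RoundsTo (G.mult u v w) ((F.mult x y z : ℝ) / (gTilde g x y z : ℝ))) ∧
      (∀ (x y z : V) (u v w : W), u ≠ v → u ≠ w → v ≠ w → Ψ u = x → Ψ v = y → Ψ w = z →
        ∀ j : Fin k,
          RoundsTo ((G.colorClass K j).mult u v w)
            (((F.colorClass K j).mult x y z : ℝ) / (gTilde g x y z : ℝ))) := by
  classical
  have := Fintype.ofFinite V
  have := Fintype.ofFinite E
  have := Fintype.ofFinite H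
  let C : Fin k → Finset E := fun j => {e | K e = j}
  have hC : (Set.range C).PairwiseDisjoint id := by
    rintro _ ⟨i, rfl⟩ _ ⟨j, rfl⟩ hij
    refine Finset.disjoint_left.2 fun e hi hj => hij ?_
    rw [← (mem_filter.1 hi).2, ← (mem_filter.1 hj).2]
  have hpos := F.typeWeight_edgeType_pos hF hg hg2 hg1
  have hle : Fintype.card V ≤ ∑ x, g x := by
    simpa using sum_le_sum fun x (_ : x ∈ univ) => Nat.succ_le_of_lt (hg x)
  obtain ⟨N, hN⟩ := Nat.exists_eq_add_of_le hle
  obtain ⟨W, _, _, ψ, Ψ, h⟩ := exists_isFairDetachment_one F.φ hC N V F.ψ g hg hpos hN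
  let G : HingedHypergraph W E H := ⟨ψ, F.φ, F.φ_surjective⟩
  have hfiber : ∀ x, g x = (Ψ ⁻¹' {x}).ncard := fun x => by
    rw [h.fiber, pushforward, ← card_eq_sum_ones, ← Set.ncard_coe_finset]
    congr 1
    ext u
    simp
  have hinj : ∀ e, Set.InjOn ψ (G.hingesAtEdge e) := by
    intro e a ha b hb hab
    have h1 : edgeType F.φ ψ e (ψ a) ≤ 1 := le_of_typeWeight_pos (h.typeWeight_pos hpos e) (ψ a)
    exact card_le_one.1 h1 a (mem_filter.2 ⟨mem_univ _, ha, rfl⟩) b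
      (mem_filter.2 ⟨mem_univ _, hb, hab.symm⟩)
  have hmult : ∀ D ∈ insert univ (Set.range C), ∀ u v w : W, u ≠ v → u ≠ w → v ≠ w →
      RoundsTo (typeMult F.φ ψ D (tripleType u v w))
        ((typeMult F.φ F.ψ D (tripleType (Ψ u) (Ψ v) (Ψ w)) : ℝ) /
          (gTilde g (Ψ u) (Ψ v) (Ψ w) : ℝ)) := by
    intro D hD u v w huv huw hvw
    have hs := h.mult D hD (tripleType u v w)
    rw [pushforward_tripleType, ← gTilde_eq_typeWeight, ← gTilde_eq_typeWeight,
      show gTilde (fun _ : W => 1) u v w = 1 by simp [gTilde, huv, huw, hvw]] at hs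
    refine .of_sharesFairly hs fun h0 => ?_
    rw [typeMult, card_eq_zero]
    refine filter_false_of_mem fun e _ he => (hpos e).ne' ?_
    rw [he, ← gTilde_eq_typeWeight, h0]
  refine ⟨W, inferInstance, G, Ψ, fun e => ⟨?_, hF e⟩, ⟨⟨fun x => ?_, h.comp, rfl⟩, hfiber⟩,
    ?_, ?_, ?_, ?_⟩
  · rw [HingedHypergraph.size, (hinj e).ncard_image]
    exact hF e
  · exact Set.nonempty_of_ncard_ne_zero (s := Ψ ⁻¹' {x}) (hfiber x ▸ (hg x).ne')
  · rintro _ u rfl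
    rw [G.degree_eq, F.degree_eq]
    exact .of_sharesFairly (h.degree _ (Set.mem_insert _ _) u) fun h0 => absurd h0 (hg _).ne'
  · rintro _ u rfl j
    rw [G.degree_colorClass_eq, F.degree_colorClass_eq]
    exact .of_sharesFairly (h.degree _ (Set.mem_insert_of_mem _ ⟨j, rfl⟩) u)
      fun h0 => absurd h0 (hg _).ne'
  · rintro _ _ _ u v w huv huw hvw rfl rfl rfl
    rw [G.mult_eq, F.mult_eq]
    exact hmult _ (Set.mem_insert _ _) u v w huv huw hvw
  · rintro _ _ _ u v w huv huw hvw rfl rfl rfl j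
    rw [G.mult_colorClass_eq, F.mult_colorClass_eq]
    exact hmult _ (Set.mem_insert_of_mem _ ⟨j, rfl⟩) u v w huv huw hvw
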